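/- Let $\mathbb F$ be a field of characteristic $0$, let $n\ge 2$, and let $\ell_1,\ell_2\in\mathbb N=\{0,1,2,\dots\}$. Let $sl(n,\mathbb F)$ act on $\mathbb F[x_1,\dots,x_n,y_1,\dots,y_n]$ by the linear extension of $E_{i,j}\mapsto x_i\partial_{x_j}-y_j\partial_{y_i}$. Let $H=\sum_{i=1}^{n-1}\mathbb F(E_{i,i}-E_{i+1,i+1})$, with fundamental weights $\lambda_1,\dots,\lambda_{n-1}\in H^*$ given by $\lambda_i(E_{j,j}-E_{j+1,j+1})=\delta_{i,j}$, and take $E_{i,j}$ $(i<j)$ as positive root vectors. Let $V_{\ell_1,\ell_2}$ be the $sl(n,\mathbb F)$-submodule generated by $x_1^{\ell_1}y_n^{\ell_2}$. Then: (1) $V_{\ell_1,\ell_2}$ is an irreducible highest weight module with highest weight $\ell_1\lambda_1+\ell_2\lambda_{n-1}$, and $x_1^{\ell_1}y_n^{\ell_2}$ is a highest weight vector: it is nonzero, has this weight, and is killed by all $E_{i,j}$ with $i<j$. (2) $V_{\ell_1,\ell_2}$ is the set of all polynomials $f$, homogeneous of degree $\ell_1$ in $x_1,\dots,x_n$ and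 homogeneous of degree $\ell_2$ in $y_1,\dots,y_n$, such that $\sum_{i=1}^n\partial_{x_i}\partial_{y_i}(f)=0$. (3) Write $|i|=i_2+\cdots+i_n$. The set consisting of the polynomials $$\sum_{i_2,\dots,i_n=0}^{\infty}\frac{(-1)^{|i|}\prod_{r=2}^n\binom{m_r}{i_r}\binom{l_r}{i_r}}{\binom{m+|i|}{m}\binom{|i|}{i_2,\dots,i_n}}\,x_1^{m+|i|}y_1^{|i|}\prod_{r=2}^n x_r^{m_r-i_r}y_r^{l_r-i_r}$$ for all $m,m_r,l_r\in\mathbb N$ with $m+\sum_{r=2}^n m_r=\ell_1$ and $\sum_{r=2}^n l_r=\ell_2$, together with the polynomials $$\sum_{i_2,\dots,i_n=0}^{\infty}\frac{(-1)^{|i|}\prod_{r=2}^n\binom{m'_r}{i_r}\binom{l'_r}{i_r}}{\binom{m'+|i|}{m'}\binom{|i|}{i_2,\dots,i_n}}\,x_1^{|i|}y_1^{m'+|i|}\prod_{r=2}^n x_r^{m'_r-i_r}y_r^{l'_r-i_r}$$ for all $m',m'_r,l'_r\in\mathbb N$ with $\sum_{r=2}^n m'_r=\ell_1$ and $m'+\sum_{r=2}^n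 l'_r=\ell_2$, is a basis of $V_{\ell_1,\ell_2}$. (The sums are finite, since the binomial coefficients vanish unless $i_r\le m_r$ and $i_r\le l_r$, respectively $i_r\le m'_r$ and $i_r\le l'_r$, for all $r$.) -/

import Mathlib

open MvPolynomial LieAlgebra.SpecialLinear

attribute [local instance 100] LieRing.ofAssociativeRing

noncomputable section

namespace SlPoly

/-- The polynomial algebra `F[x₁,…,xₙ,y₁,…,yₙ]`; the indices `1,…,n` are the elements
`0,…,n-1` of `Fin n`. -/
abbrev Poly (n : ℕ) (F : Type*) [Field F] : Type _ := MvPolynomial (Fin n ⊕ Fin n) F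

section Action

variable {n : ℕ} {F : Type*} [Field F]

/-- The variable `x_i`. -/
abbrev x (i : Fin n) : Poly n F := X (Sum.inl i)

/-- The variable `y_i`. -/
abbrev y (i : Fin n) : Poly n F := X (Sum.inr i)

/-- The derivation `∂/∂x_i`. -/
abbrev dx (i : Fin n) : Derivation F (Poly n F) (Poly n F) := pderiv (Sum.inl i)

/-- The derivation `∂/∂y_i`. -/
abbrev dy (i : Fin n) : Derivation F (Poly n F) (Poly n F) := pderiv (Sum.inr i)

/-- The operator `x_i ∂_{x_j} - y_j ∂_{y_i}`, by which `E_{i,j}` acts. -/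
def opE (i j : Fin n) : Derivation F (Poly n F) (Poly n F) :=
  (x i : Poly n F) • dx j - (y j : Poly n F) • dy i

/-- The linear extension of `E_{i,j} ↦ x_i ∂_{x_j} - y_j ∂_{y_i}` to all matrices. -/
def act (A : Matrix (Fin n) (Fin n) F) : Derivation F (Poly n F) (Poly n F) :=
  ∑ i, ∑ j, A i j • opE i j

theorem act_apply (A : Matrix (Fin n) (Fin n) F) (p : Poly n F) :
    act A p = ∑ i, ∑ j, A i j • (x i * dx j p - y j * dy i p) := by
  simp only [act, opE]
  rw [← Derivation.coeFnAddMonoidHom_apply]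
  simp only [map_sum, Finset.sum_apply]
  rfl

theorem act_x (A : Matrix (Fin n) (Fin n) F) (k : Fin n) :
    act A (x k) = ∑ i, A i k • (x i : Poly n F) := by
  rw [act_apply]
  refine Finset.sum_congr rfl fun i _ => ?_
  rw [Finset.sum_eq_single k]
  · simp [pderiv_X]
  · intro j _ hj
    simp [pderiv_X, hj.symm]
  · simp

theorem act_y (A : Matrix (Fin n) (Fin n) F) (k : Fin n) :
    act A (y k) = - ∑ j, A k j • (y j : Poly n F) := by
  rw [act_apply, Finset.sum_eq_single k]
  · simp [pderiv_X]
  · intro i _ hi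
    simp [pderiv_X, hi.symm]
  · simp

theorem act_single (i j : Fin n) : act (Matrix.single i j (1 : F)) = opE i j := by
  rw [act, Finset.sum_eq_single i, Finset.sum_eq_single j]
  · simp
  · intro b _ hb
    simp [hb.symm]
  · simp
  · intro b _ hb
    simp [hb.symm]
  · simp

theorem act_lie (A B : Matrix (Fin n) (Fin n) F) : act ⁅A, B⁆ = ⁅act A, act B⁆ := by
  refine MvPolynomial.derivation_ext ?_
  rintro (k | k)
  · have h : ∀ P Q : Matrix (Fin n) (Fin n) F,
        act P (act Q (x k)) = ∑ i, (P * Q) i k • (x i : Poly n F) := by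
      intro P Q
      rw [act_x, map_sum]
      simp_rw [Derivation.map_smul, act_x, Matrix.mul_apply, Finset.sum_smul, Finset.smul_sum,
        smul_smul]
      rw [Finset.sum_comm]
      simp_rw [mul_comm]
    rw [Derivation.commutator_apply, h, h, act_x, ← Finset.sum_sub_distrib]
    simp_rw [← sub_smul]
    rfl
  · have h : ∀ P Q : Matrix (Fin n) (Fin n) F,
        act P (act Q (y k)) = ∑ i, (Q * P) k i • (y i : Poly n F) := by
      intro P Q
      rw [act_y, map_neg, map_sum]
      simp_rw [Derivation.map_smul, act_y, Matrix.mul_apply, Finset.sum_smul, smul_neg,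
        Finset.sum_neg_distrib, neg_neg, Finset.smul_sum, smul_smul]
      rw [Finset.sum_comm]
    rw [Derivation.commutator_apply, h, h, act_y, ← Finset.sum_sub_distrib,
      ← Finset.sum_neg_distrib]
    simp_rw [← sub_smul, ← neg_smul]
    refine Finset.sum_congr rfl fun i _ => ?_
    congr 1
    exact neg_sub _ _

variable (n F) in
/-- The representation of the Lie algebra of all `n × n` matrices on `F[x,y]` by derivations. -/
def glRep : Matrix (Fin n) (Fin n) F →ₗ⁅F⁆ Derivation F (Poly n F) (Poly n F) where
  toFun := act
  map_add' A B := by simp [act, add_smul, Finset.sum_add_distrib]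
  map_smul' c A := by simp [act, mul_smul, Finset.smul_sum]
  map_lie' := act_lie _ _

/-- `F[x,y]` as a module over `sl(n,F)`. -/
instance instLieRingModule : LieRingModule (sl (Fin n) F) (Poly n F) :=
  LieRingModule.compLieHom (Poly n F) ((glRep n F).comp (sl (Fin n) F).incl)

instance instLieModule : LieModule F (sl (Fin n) F) (Poly n F) :=
  LieModule.compLieHom (Poly n F) ((glRep n F).comp (sl (Fin n) F).incl)

theorem lie_def (A : sl (Fin n) F) (p : Poly n F) : ⁅A, p⁆ = act A.1 p := rfl

theorem lie_single (i j : Fin n) (h : i ≠ j) (p : Poly n F) :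
    ⁅single i j h (1 : F), p⁆ = x i * dx j p - y j * dy i p := by
  rw [lie_def, val_single, act_single]
  rfl

end Action

section Weights

variable (n : ℕ) (F : Type*) [Field F]

/-- The Cartan subalgebra `H` of `sl(n,F)`, spanned by `E_{i,i} - E_{i+1,i+1}`. -/
def cartan : Submodule F (sl (Fin n) F) :=
  Submodule.span F {h | ∃ i j : Fin n, (j : ℕ) = i + 1 ∧ h = singleSubSingle i j (1 : F)}

/-- The fundamental weight `λ_k` (`1 ≤ k ≤ n-1`), a linear function on `H`: the sum of the first
`k` diagonal entries. It is characterised by `λ_k (E_{i,i} - E_{i+1,i+1}) = δ_{k,i}`, see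
`fundamentalWeight_apply`. -/
def fundamentalWeight (k : ℕ) : Module.Dual F (cartan n F) where
  toFun h := ∑ j : Fin n, if (j : ℕ) < k then (h.1.1 j j : F) else 0
  map_add' a b := by
    rw [← Finset.sum_add_distrib]
    refine Finset.sum_congr rfl fun j _ => ?_
    split_ifs <;> simp
  map_smul' c a := by
    rw [RingHom.id_apply, Finset.smul_sum]
    refine Finset.sum_congr rfl fun j _ => ?_
    split_ifs <;> simp

/-- With `i` zero-based, `E_{i+1,i+1} - E_{i+2,i+2}` in one-based numbering is sent to
`δ_{k,i+1}`. -/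
theorem fundamentalWeight_apply (k : ℕ) (i j : Fin n) (hij : (j : ℕ) = i + 1) :
    fundamentalWeight n F k
      ⟨singleSubSingle i j (1 : F), Submodule.subset_span ⟨i, j, hij, rfl⟩⟩ =
      if k = i + 1 then 1 else 0 := by
  have key : ∀ a : Fin n, (∑ l : Fin n, if (l : ℕ) < k then
      (Matrix.single a a (1 : F)) l l else 0) = if (a : ℕ) < k then 1 else 0 := by
    intro a
    rw [Finset.sum_eq_single a]
    · simp
    · intro b _ hb
      simp [Matrix.single, hb.symm]
    · simp
  have h : fundamentalWeight n F k
      ⟨singleSubSingle i j (1 : F), Submodule.subset_span ⟨i, j, hij, rfl⟩⟩ =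
      (∑ l : Fin n, if (l : ℕ) < k then (Matrix.single i i (1 : F)) l l else 0) -
      (∑ l : Fin n, if (l : ℕ) < k then (Matrix.single j j (1 : F)) l l else 0) := by
    change (∑ l : Fin n, if (l : ℕ) < k then (singleSubSingle i j (1 : F)).1 l l else 0) = _
    rw [← Finset.sum_sub_distrib]
    refine Finset.sum_congr rfl fun l _ => ?_
    split_ifs <;> simp
  rw [h, key, key, hij]
  split_ifs <;> first | omega | simp

variable {n F}

/-- A singular (highest weight) vector of weight `lam`: nonzero, killed by the positive root
vectors `E_{i,j}`, `i < j`, and a weight vector of weight `lam` for the Cartan subalgebra. -/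
structure IsSingularVector {M : Type*} [AddCommGroup M] [Module F M]
    [LieRingModule (sl (Fin n) F) M] (lam : Module.Dual F (cartan n F)) (v : M) : Prop where
  ne_zero : v ≠ 0
  lie_pos : ∀ (i j : Fin n) (hij : i < j), ⁅single i j hij.ne (1 : F), v⁆ = 0
  lie_cartan : ∀ h : cartan n F, ⁅(h : sl (Fin n) F), v⁆ = lam h • v

/-- `M` is a highest weight module of highest weight `lam`: it is generated by a singular vector
of weight `lam`. -/
def IsHighestWeightModule (M : Type*) [AddCommGroup M] [Module F M]
    [LieRingModule (sl (Fin n) F) M] (lam : Module.Dual F (cartan n F)) : Prop :=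
  ∃ v : M, IsSingularVector lam v ∧ LieSubmodule.lieSpan F (sl (Fin n) F) {v} = ⊤

end Weights

section Spaces

/-- The first index (`1` in one-based numbering). -/
def fst {n : ℕ} (hn : 2 ≤ n) : Fin n := ⟨0, by omega⟩

/-- The last index (`n` in one-based numbering). -/
def lst {n : ℕ} (hn : 2 ≤ n) : Fin n := ⟨n - 1, by omega⟩

/-- `x₁^{ℓ₁} yₙ^{ℓ₂}`. -/
def gen {n : ℕ} (hn : 2 ≤ n) (F : Type*) [Field F] (l₁ l₂ : ℕ) : Poly n F :=
  x (fst hn) ^ l₁ * y (lst hn) ^ l₂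

/-- `V_{ℓ₁,ℓ₂}`: the `sl(n,F)`-submodule of `F[x,y]` generated by `x₁^{ℓ₁} yₙ^{ℓ₂}`. -/
def V {n : ℕ} (hn : 2 ≤ n) (F : Type*) [Field F] (l₁ l₂ : ℕ) :
    LieSubmodule F (sl (Fin n) F) (Poly n F) :=
  LieSubmodule.lieSpan F (sl (Fin n) F) {gen hn F l₁ l₂}

variable (n : ℕ) (F : Type*) [Field F]

/-- The polynomials that are homogeneous of degree `ℓ₁` in the `x_i` and of degree `ℓ₂` in the
`y_i` (with `0`). -/
def bihomogeneous (l₁ l₂ : ℕ) : Submodule F (Poly n F) :=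
  weightedHomogeneousSubmodule F
    (Sum.elim (fun _ => ((1, 0) : ℕ × ℕ)) (fun _ => ((0, 1) : ℕ × ℕ))) (l₁, l₂)

/-- `Δ = ∑ ∂_{x_i} ∂_{y_i}`. -/
def Delta : Poly n F →ₗ[F] Poly n F :=
  ∑ i : Fin n, (dx i).toLinearMap ∘ₗ (dy i).toLinearMap

/-- `H_{ℓ₁,ℓ₂}`: the kernel of `Δ` on bihomogeneous polynomials of bidegree `(ℓ₁,ℓ₂)`. -/
def harmonic (l₁ l₂ : ℕ) : Submodule F (Poly n F) :=
  bihomogeneous n F l₁ l₂ ⊓ LinearMap.ker (Delta n F)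

end Spaces

section ExplicitBasis

/-- The indices `2,…,n` (one-based), i.e. all indices but the first. -/
abbrev Rest (n : ℕ) : Type := {r : Fin n // 0 < (r : ℕ)}

variable {n : ℕ} (hn : 2 ≤ n) (F : Type*) [Field F]

/-- The element of the first family. The sum runs over the tuples `i = (i₂,…,iₙ)` with
`i_r ≤ μ_r` and `i_r ≤ ν_r` for all `r`; all other tuples contribute zero since
`(μ_r choose i_r) (ν_r choose i_r)` vanishes for some `r`. -/
def basisFst (m : ℕ) (μ ν : Rest n → ℕ) : Poly n F :=
  ∑ i ∈ Finset.Iic (μ ⊓ ν),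
    C (((-1) ^ (∑ r, i r) * ∏ r, (((μ r).choose (i r) : F) * ((ν r).choose (i r) : F))) /
        (((m + ∑ r, i r).choose m : F) * (Nat.multinomial Finset.univ i : F))) *
      (x (fst hn) ^ (m + ∑ r, i r) * y (fst hn) ^ (∑ r, i r) *
        ∏ r : Rest n, (x r.1 ^ (μ r - i r) * y r.1 ^ (ν r - i r)))

/-- The element of the second family, with the same conventions. -/
def basisSnd (m : ℕ) (μ ν : Rest n → ℕ) : Poly n F :=
  ∑ i ∈ Finset.Iic (μ ⊓ ν),
    C (((-1) ^ (∑ r, i r) * ∏ r, (((μ r).choose (i r) : F) * ((ν r).choose (i r) : F))) /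
        (((m + ∑ r, i r).choose m : F) * (Nat.multinomial Finset.univ i : F))) *
      (x (fst hn) ^ (∑ r, i r) * y (fst hn) ^ (m + ∑ r, i r) *
        ∏ r : Rest n, (x r.1 ^ (μ r - i r) * y r.1 ^ (ν r - i r)))

/-- The union of the two families in bidegree `(ℓ₁,ℓ₂)`, as a set of polynomials. -/
def basisSet (l₁ l₂ : ℕ) : Set (Poly n F) :=
  {f | ∃ (m : ℕ) (μ ν : Rest n → ℕ),
      m + ∑ r, μ r = l₁ ∧ ∑ r, ν r = l₂ ∧ f = basisFst hn F m μ ν} ∪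
  {f | ∃ (m : ℕ) (μ ν : Rest n → ℕ),
      ∑ r, μ r = l₁ ∧ m + ∑ r, ν r = l₂ ∧ f = basisSnd hn F m μ ν}

end ExplicitBasis

end SlPoly

end

/-
For the apolar form, in which distinct monomials are orthogonal and `⟨x^a y^b, x^a y^b⟩ = a! b!`,
the operator `E_{i,j}` is adjoint to `E_{j,i}`. A nonzero invariant space of harmonic polynomials
contains a nonzero polynomial killed by all `E_{i,j}` with `i < j`, and together with `Δ f = 0`
this forces it to be a multiple of `x₁^{ℓ₁} y_n^{ℓ₂}`. Hence `V` lies in every nonzero invariant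
space of harmonic polynomials, so it is irreducible. The orthogonal complement of `V` in the
harmonic polynomials is invariant and does not contain `x₁^{ℓ₁} y_n^{ℓ₂}`, so it is zero and `V`
is the whole harmonic space. For the basis, `Δ f = 0` determines `f` by its coefficients at
monomials not divisible by `x₁ y₁`, and each listed polynomial contains exactly one such monomial,
with coefficient one.
-/

namespace SlPoly

section Polynomial

variable {σ R : Type*} [CommSemiring R]

theorem coeff_add_single_X_mul_pderiv (a b : σ) (f : MvPolynomial σ R) (u : σ →₀ ℕ) :
    coeff (u + Finsupp.single a 1) (X a * pderiv b f) =
      coeff (u + Finsupp.single b 1) f * (u b + 1) := by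
  rw [add_comm u, coeff_X_mul, coeff_pderiv]

theorem exists_of_coeff_X_mul_pderiv_ne_zero {a b : σ} {f : MvPolynomial σ R} {t : σ →₀ ℕ}
    (h : coeff t (X a * pderiv b f) ≠ 0) :
    ∃ u, t = u + Finsupp.single a 1 ∧ coeff (u + Finsupp.single b 1) f ≠ 0 := by
  classical
  have ha : t a ≠ 0 := by
    intro ha
    rw [coeff_X_mul', if_neg (by simpa using ha)] at h
    exact h rfl
  obtain ⟨u, rfl⟩ : ∃ u, t = u + Finsupp.single a 1 :=
    ⟨t - Finsupp.single a 1, (Finsupp.sub_add_single_one_cancel ha).symm⟩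
  rw [coeff_add_single_X_mul_pderiv] at h
  exact ⟨u, rfl, left_ne_zero_of_mul h⟩

theorem isWeightedHomogeneous_X_mul_pderiv {M : Type*} [AddCommMonoid M] {w : σ → M} {a b : σ}
    (h : w a = w b) {d : M} {f : MvPolynomial σ R} (hf : IsWeightedHomogeneous w f d) :
    IsWeightedHomogeneous w (X a * pderiv b f) d := by
  intro t ht
  obtain ⟨u, rfl, hu⟩ := exists_of_coeff_X_mul_pderiv_ne_zero ht
  simpa [Finsupp.weight_single, h] using hf hu

theorem weight_lt_of_coeff_X_mul_pderiv_ne_zero {w : σ → ℕ} {a b : σ} (h : w a < w b)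
    {f : MvPolynomial σ R} {t : σ →₀ ℕ} (ht : coeff t (X a * pderiv b f) ≠ 0) :
    Finsupp.weight w t < weightedTotalDegree w f := by
  obtain ⟨u, rfl, hu⟩ := exists_of_coeff_X_mul_pderiv_ne_zero ht
  refine lt_of_lt_of_le ?_ (le_weightedTotalDegree w (mem_support_iff.2 hu))
  simpa [Finsupp.weight_single] using h

theorem pderiv_comm (a b : σ) (f : MvPolynomial σ R) :
    pderiv a (pderiv b f) = pderiv b (pderiv a f) := by
  classical
  ext u
  rw [coeff_pderiv, coeff_pderiv, coeff_pderiv, coeff_pderiv, add_right_comm]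
  rcases eq_or_ne a b with rfl | h
  · rfl
  · simp [h, h.symm, mul_right_comm]

theorem apply_eq_zero_of_pderiv_eq_zero [NoZeroDivisors R] [CharZero R] {a : σ}
    {f : MvPolynomial σ R} (h : pderiv a f = 0) {s : σ →₀ ℕ} (hs : coeff s f ≠ 0) : s a = 0 := by
  by_contra ha
  have hc := congrArg (coeff (s - Finsupp.single a 1)) h
  rw [coeff_pderiv, Finsupp.sub_add_single_one_cancel ha, coeff_zero, mul_eq_zero] at hc
  exact hc.elim hs (Nat.cast_add_one_ne_zero _)

theorem eq_zero_of_sum_pderiv_X_mul_eq_zero [NoZeroDivisors R] [CharZero R] {ι : Type*} [Fintype ι]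
    [Nonempty ι] (v : ι → σ) {g : MvPolynomial σ R}
    (h : ∑ k, pderiv (v k) (X (v k) * g) = 0) : g = 0 := by
  ext u
  have hu : coeff u g * ((∑ k, (u (v k) + 1) : ℕ) : R) = 0 := by
    have := congrArg (coeff u) h
    rw [coeff_sum, coeff_zero] at this
    rw [← this, Nat.cast_sum, Finset.mul_sum]
    refine Finset.sum_congr rfl fun k _ => ?_
    rw [coeff_pderiv, add_comm u, coeff_X_mul, Nat.cast_add_one]
  refine (mul_eq_zero.1 hu).resolve_right (Nat.cast_ne_zero.2 ?_)
  exact (Finset.sum_pos (fun _ _ => Nat.succ_pos _) Finset.univ_nonempty).ne'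

end Polynomial

section ApolarForm

open scoped Nat

variable {σ R : Type*} [CommSemiring R]

variable (σ R) in
/-- The apolar form on polynomials: monomials are pairwise orthogonal, and the square of the
monomial with exponent `s` is `∏ i, (s i)!`. Multiplication by a variable is adjoint to the
corresponding partial derivative. -/
noncomputable def apolar : LinearMap.BilinForm R (MvPolynomial σ R) :=
  (basisMonomials σ R).constr R fun s => (s.prod fun _ k => (k ! : R)) • lcoeff R s

theorem apolar_monomial (s : σ →₀ ℕ) (a : R) (g : MvPolynomial σ R) :
    apolar σ R (monomial s a) g = a * ((s.prod fun _ k => (k ! : R)) * coeff s g) := by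
  have : monomial s a = a • basisMonomials σ R s := by simp [smul_monomial]
  rw [this, map_smul, apolar, Module.Basis.constr_basis]
  rfl

theorem isSymm_apolar : (apolar σ R).IsSymm := by
  classical
  refine ⟨fun f g => ?_⟩
  induction f using MvPolynomial.induction_on' with
  | add p q hp hq => rw [map_add, map_add, LinearMap.add_apply, hp, hq]
  | monomial s a =>
    induction g using MvPolynomial.induction_on' with
    | add p q hp hq => rw [map_add, map_add, LinearMap.add_apply, hp, hq]
    | monomial t b =>
      rw [apolar_monomial, apolar_monomial, coeff_monomial, coeff_monomial]
      rcases eq_or_ne s t with rfl | h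
      · simp only [if_true]
        ring
      · simp [h, h.symm]

theorem prod_factorial_add_single (s : σ →₀ ℕ) (i : σ) :
    ((s + Finsupp.single i 1).prod fun _ k => (k ! : R)) =
      (s.prod fun _ k => (k ! : R)) * (s i + 1) := by
  rw [← Finsupp.mul_prod_erase' (s + Finsupp.single i 1) i _ (by simp),
    ← Finsupp.mul_prod_erase' s i _ (by simp), Finsupp.erase_add, Finsupp.erase_single, add_zero,
    Finsupp.add_apply, Finsupp.single_eq_same, Nat.factorial_succ]
  push_cast
  ring

theorem apolar_X_mul (i : σ) (f g : MvPolynomial σ R) :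
    apolar σ R (X i * f) g = apolar σ R f (pderiv i g) := by
  induction f using MvPolynomial.induction_on' with
  | add p q hp hq =>
    rw [mul_add, map_add, map_add, LinearMap.add_apply, LinearMap.add_apply, hp, hq]
  | monomial s a =>
    rw [X, monomial_mul, one_mul, add_comm, apolar_monomial, apolar_monomial, coeff_pderiv,
      prod_factorial_add_single]
    ring

theorem apolar_pderiv (i : σ) (f g : MvPolynomial σ R) :
    apolar σ R (pderiv i f) g = apolar σ R f (X i * g) := by
  rw [isSymm_apolar.eq, ← apolar_X_mul, isSymm_apolar.eq]

theorem apolar_monomial_self_ne_zero [NoZeroDivisors R] [CharZero R] (s : σ →₀ ℕ) :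
    apolar σ R (monomial s 1) (monomial s 1) ≠ 0 := by
  classical
  have : Nontrivial R := (Nat.cast_injective (R := R)).nontrivial
  rw [apolar_monomial, coeff_monomial, if_pos rfl, one_mul, mul_one]
  exact Finset.prod_ne_zero_iff.2 fun i _ => Nat.cast_ne_zero.2 (Nat.factorial_ne_zero _)

end ApolarForm

section LinearAlgebra

theorem eq_of_le_of_disjoint_orthogonal {K M : Type*} [Field K] [AddCommGroup M] [Module K M]
    {B : LinearMap.BilinForm K M} {U W : Submodule K M} [FiniteDimensional K W] (hUW : U ≤ W)
    (h : Disjoint W (B.orthogonal U)) : U = W := by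
  have : FiniteDimensional K U := Submodule.finiteDimensional_of_le hUW
  refine Submodule.eq_of_le_of_finrank_le hUW ?_
  rw [← Subspace.dual_finrank_eq (V := U)]
  refine LinearMap.finrank_le_finrank_of_injective (f := B.flip.domRestrict₁₂ W U) ?_
  refine (injective_iff_map_eq_zero _).2 fun w hw => Subtype.ext ?_
  exact Submodule.disjoint_def.1 h w w.2 fun u hu => LinearMap.congr_fun hw ⟨u, hu⟩

theorem isIrreducible_of_isAtom {R L M : Type*} [CommRing R] [LieRing L] [AddCommGroup M]
    [Module R M] [LieRingModule L M] {N : LieSubmodule R L M} (hN : IsAtom N) :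
    LieModule.IsIrreducible R L N := by
  have : Nontrivial N := (LieSubmodule.nontrivial_iff_ne_bot R L M).2 hN.1
  refine LieModule.IsIrreducible.mk fun N' hN' => by_contra fun htop => hN' ?_
  have hbot : N'.map N.incl = ⊥ :=
    hN.2 _ (LieSubmodule.map_incl_lt_iff_lt_top.2 (lt_top_iff_ne_top.2 htop))
  exact LieSubmodule.map_injective_of_injective (f := N.incl) Subtype.coe_injective
    (hbot.trans LieSubmodule.map_bot.symm)

end LinearAlgebra

section Action

variable {n : ℕ} {F : Type*} [Field F]

theorem opE_apply (i j : Fin n) (f : Poly n F) : opE i j f = x i * dx j f - y j * dy i f := rfl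

theorem act_mem {N : Submodule F (Poly n F)} (A : Matrix (Fin n) (Fin n) F) {f : Poly n F}
    (hN : ∀ i j, opE i j f ∈ N) : act A f ∈ N := by
  rw [act_apply]
  exact N.sum_mem fun i _ => N.sum_mem fun j _ => N.smul_mem _ (hN i j)

theorem apolar_opE (i j : Fin n) (f g : Poly n F) :
    apolar _ F (opE i j f) g = apolar _ F f (opE j i g) := by
  rw [opE_apply, opE_apply, map_sub, LinearMap.sub_apply, map_sub, apolar_X_mul, apolar_pderiv,
    apolar_X_mul, apolar_pderiv]

theorem apolar_act (A : Matrix (Fin n) (Fin n) F) (f g : Poly n F) :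
    apolar _ F (act A f) g = apolar _ F f (act A.transpose g) := by
  rw [act_apply, act_apply, Finset.sum_comm]
  simp only [← opE_apply, map_sum, map_smul, LinearMap.sum_apply, LinearMap.smul_apply, apolar_opE,
    Matrix.transpose_apply]

/-- The orthogonal complement of a Lie submodule with respect to the apolar form. It is a Lie
submodule because the adjoint of the action of `A` is the action of the transpose of `A`. -/
noncomputable def apolarOrthogonal (N : LieSubmodule F (sl (Fin n) F) (Poly n F)) :
    LieSubmodule F (sl (Fin n) F) (Poly n F) where
  __ := (apolar (Fin n ⊕ Fin n) F).orthogonal N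
  lie_mem {A f} hf := by
    intro g hg
    have hA : Matrix.trace A.1.transpose = 0 := (Matrix.trace_transpose _).trans A.2
    have hlie : ⁅(⟨A.1.transpose, hA⟩ : sl (Fin n) F), g⁆ ∈ N := N.lie_mem hg
    change apolar _ F g (act A.1 f) = 0
    rw [← A.1.transpose_transpose, ← apolar_act]
    exact hf _ hlie

theorem dx_opE (i j k : Fin n) (f : Poly n F) :
    dx k (opE i j f) = opE i j (dx k f) + if k = i then dx j f else 0 := by
  classical
  rw [opE_apply, opE_apply, map_sub, pderiv_mul, pderiv_mul, pderiv_comm _ (Sum.inl j),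
    pderiv_comm _ (Sum.inr i), pderiv_X, pderiv_X]
  rcases eq_or_ne k i with rfl | h
  · simp
    ring
  · simp [h, h.symm]

theorem dy_opE (i j k : Fin n) (f : Poly n F) :
    dy k (opE i j f) = opE i j (dy k f) - if k = j then dy i f else 0 := by
  classical
  rw [opE_apply, opE_apply, map_sub, pderiv_mul, pderiv_mul, pderiv_comm _ (Sum.inl j),
    pderiv_comm _ (Sum.inr i), pderiv_X, pderiv_X]
  rcases eq_or_ne k j with rfl | h
  · simp
    ring
  · simp [h, h.symm]

theorem Delta_apply (f : Poly n F) : Delta n F f = ∑ k, dx k (dy k f) := by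
  simp [Delta]

theorem Delta_opE (i j : Fin n) (f : Poly n F) :
    Delta n F (opE i j f) = opE i j (Delta n F f) := by
  have hk (k : Fin n) : dx k (dy k (opE i j f)) =
      opE i j (dx k (dy k f)) + (if k = i then dx j (dy k f) else 0) -
        if k = j then dx k (dy i f) else 0 := by
    rw [dy_opE, map_sub, dx_opE, apply_ite (dx k), map_zero]
  simp only [Delta_apply, hk, map_sum, Finset.sum_sub_distrib, Finset.sum_add_distrib,
    Finset.sum_ite_eq', Finset.mem_univ, if_true]
  rw [add_sub_cancel_right]

end Action

section Harmonic

variable {n : ℕ} {F : Type*} [Field F]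

theorem mem_bihomogeneous_iff {l₁ l₂ : ℕ} {f : Poly n F} :
    f ∈ bihomogeneous n F l₁ l₂ ↔ ∀ s, coeff s f ≠ 0 →
      ∑ k, s (.inl k) = l₁ ∧ ∑ k, s (.inr k) = l₂ := by
  have hw (s : Fin n ⊕ Fin n →₀ ℕ) :
      Finsupp.weight (Sum.elim (fun _ => ((1, 0) : ℕ × ℕ)) (fun _ => ((0, 1) : ℕ × ℕ))) s =
        (∑ k, s (.inl k), ∑ k, s (.inr k)) := by
    rw [Finsupp.weight_eq_sum]
    ext <;> simp [Prod.fst_sum, Prod.snd_sum]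
  rw [bihomogeneous, mem_weightedHomogeneousSubmodule, IsWeightedHomogeneous]
  simp only [hw, Prod.mk.injEq]

theorem monomial_mem_bihomogeneous {l₁ l₂ : ℕ} {s : Fin n ⊕ Fin n →₀ ℕ}
    (h₁ : ∑ k, s (.inl k) = l₁) (h₂ : ∑ k, s (.inr k) = l₂) (c : F) :
    monomial s c ∈ bihomogeneous n F l₁ l₂ := by
  classical
  refine mem_bihomogeneous_iff.2 fun t ht => ?_
  rw [coeff_monomial] at ht
  obtain rfl := (ite_ne_right_iff.1 ht).1
  exact ⟨h₁, h₂⟩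

theorem finite_bihomogeneous (l₁ l₂ : ℕ) : Module.Finite F (bihomogeneous n F l₁ l₂) := by
  refine Submodule.finiteDimensional_of_le (S₂ := restrictTotalDegree _ F (l₁ + l₂)) ?_
  intro f hf
  rw [mem_restrictTotalDegree, totalDegree]
  refine Finset.sup_le fun s hs => ?_
  obtain ⟨rfl, rfl⟩ := mem_bihomogeneous_iff.1 hf s (mem_support_iff.1 hs)
  rw [Finsupp.sum_fintype _ _ (fun _ => rfl), Fintype.sum_sum_type]

theorem opE_mem_bihomogeneous {l₁ l₂ : ℕ} (i j : Fin n) {f : Poly n F}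
    (hf : f ∈ bihomogeneous n F l₁ l₂) : opE i j f ∈ bihomogeneous n F l₁ l₂ :=
  Submodule.sub_mem _
    (isWeightedHomogeneous_X_mul_pderiv (a := Sum.inl i) (b := Sum.inl j) rfl hf)
    (isWeightedHomogeneous_X_mul_pderiv (a := Sum.inr j) (b := Sum.inr i) rfl hf)

variable (n F) in
/-- `harmonic n F l₁ l₂` as a module over `sl(n,F)`. -/
noncomputable def harmonicLie (l₁ l₂ : ℕ) : LieSubmodule F (sl (Fin n) F) (Poly n F) where
  __ := harmonic n F l₁ l₂
  lie_mem {A f} hf := by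
    refine act_mem (N := harmonic n F l₁ l₂) A.1 fun i j => ⟨opE_mem_bihomogeneous i j hf.1, ?_⟩
    have hΔ : Delta n F f = 0 := hf.2
    rw [SetLike.mem_coe, LinearMap.mem_ker, Delta_opE, hΔ, map_zero]

end Harmonic

section Singular

variable {n : ℕ} {F : Type*} [Field F]

/-- The weights `k` of `x_k` and `n - 1 - k` of `y_k`: every positive root vector replaces a
variable by one of smaller weight. -/
def depth : Fin n ⊕ Fin n → ℕ :=
  Sum.elim (fun k => k) (fun k => n - 1 - k)

theorem weightedTotalDegree_depth_opE_lt {i j : Fin n} (hij : i < j) {f : Poly n F}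
    (h : opE i j f ≠ 0) :
    weightedTotalDegree depth (opE i j f) < weightedTotalDegree depth f := by
  obtain ⟨t, ht, hmax⟩ := Finset.exists_mem_eq_sup _ (support_nonempty.2 h) (Finsupp.weight depth)
  have hcoeff : coeff t (x i * dx j f) - coeff t (y j * dy i f) ≠ 0 := mem_support_iff.1 ht
  rw [weightedTotalDegree, hmax]
  by_cases hx : coeff t (x i * dx j f) = 0
  · rw [hx, zero_sub, neg_ne_zero] at hcoeff
    refine weight_lt_of_coeff_X_mul_pderiv_ne_zero ?_ hcoeff
    simp only [depth, Sum.elim_inr]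
    omega
  · exact weight_lt_of_coeff_X_mul_pderiv_ne_zero
      (by simpa only [depth, Sum.elim_inl] using Fin.lt_def.1 hij) hx

theorem exists_ne_zero_forall_opE_eq_zero {N : Submodule F (Poly n F)} (hN : N ≠ ⊥)
    (hE : ∀ i j, i < j → ∀ f ∈ N, opE i j f ∈ N) :
    ∃ f ∈ N, f ≠ 0 ∧ ∀ i j, i < j → opE i j f = 0 := by
  obtain ⟨f, ⟨hf, hf0⟩, hmin⟩ := exists_minimalFor_of_wellFoundedLT
    (fun f : Poly n F => f ∈ N ∧ f ≠ 0) (weightedTotalDegree depth) (N.ne_bot_iff.1 hN)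
  refine ⟨f, hf, hf0, fun i j hij => by_contra fun h => ?_⟩
  have hlt := weightedTotalDegree_depth_opE_lt hij h
  exact hlt.not_ge (hmin ⟨hE i j hij f hf, h⟩ hlt.le)

theorem X_dvd_of_X_dvd_X_mul {σ R : Type*} [CommRing R] [IsDomain R] {a b : σ} (hab : a ≠ b)
    {f : MvPolynomial σ R} (h : X a ∣ X b * f) : X a ∣ f :=
  ((X_prime (i := a)).dvd_or_dvd h).resolve_left fun h => hab (X_dvd_X.1 h)

theorem x_dvd_dy_of_opE_eq_zero {i j : Fin n} {f : Poly n F} (h : opE i j f = 0) :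
    x i ∣ dy i f :=
  X_dvd_of_X_dvd_X_mul Sum.inl_ne_inr ⟨dx j f, (sub_eq_zero.1 h).symm⟩

theorem dx_eq_y_mul_of_opE_eq_zero {i j : Fin n} {f g : Poly n F} (h : opE i j f = 0)
    (hg : dy i f = x i * g) : dx j f = y j * g := by
  rw [opE_apply, hg, mul_left_comm, ← mul_sub] at h
  exact sub_eq_zero.1 ((mul_eq_zero.1 h).resolve_left (X_ne_zero _))

variable {hn : 2 ≤ n}

theorem fst_lt {r : Fin n} (h : r ≠ fst hn) : fst hn < r := by
  simp only [fst, ne_eq, Fin.ext_iff, Fin.lt_def] at h ⊢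
  omega

theorem lt_lst {r : Fin n} (h : r ≠ lst hn) : r < lst hn := by
  simp only [lst, ne_eq, Fin.ext_iff, Fin.lt_def] at h ⊢
  omega

variable (hn) in
theorem fst_ne_lst : fst hn ≠ lst hn := by
  simp only [fst, lst, ne_eq, Fin.ext_iff]
  omega

theorem dy_fst_eq_zero [CharZero F] {f : Poly n F} (hΔ : Delta n F f = 0)
    (hf : ∀ j, fst hn < j → opE (fst hn) j f = 0) : dy (fst hn) f = 0 := by
  classical
  obtain ⟨g, hg⟩ := x_dvd_dy_of_opE_eq_zero (hf _ (fst_lt (fst_ne_lst hn).symm))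
  have : Nonempty (Fin n) := ⟨fst hn⟩
  suffices g = 0 by rw [hg, this, mul_zero]
  refine eq_zero_of_sum_pderiv_X_mul_eq_zero
    (fun k : Fin n => if k = fst hn then Sum.inl k else Sum.inr k) ?_
  rw [← hΔ, Delta_apply]
  refine Finset.sum_congr rfl fun k _ => ?_
  split_ifs with hk
  · rw [hk, hg]
  · rw [pderiv_comm, dx_eq_y_mul_of_opE_eq_zero (hf k (fst_lt hk)) hg]

theorem dx_eq_zero_of_ne_fst [CharZero F] {f : Poly n F} (hΔ : Delta n F f = 0)
    (hf : ∀ j, fst hn < j → opE (fst hn) j f = 0) {r : Fin n} (hr : r ≠ fst hn) : dx r f = 0 := by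
  rw [dx_eq_y_mul_of_opE_eq_zero (g := 0) (hf r (fst_lt hr)), mul_zero]
  rw [dy_fst_eq_zero hΔ hf, mul_zero]

theorem dy_eq_zero_of_ne_lst [CharZero F] {f : Poly n F} (hΔ : Delta n F f = 0)
    (hf : ∀ i j, i < j → opE i j f = 0) {r : Fin n} (hr : r ≠ lst hn) : dy r f = 0 := by
  have h := hf r (lst hn) (lt_lst hr)
  rw [opE_apply, dx_eq_zero_of_ne_fst hΔ (hf _) (fst_ne_lst hn).symm, mul_zero, zero_sub,
    neg_eq_zero] at h
  exact (mul_eq_zero.1 h).resolve_left (X_ne_zero _)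

variable (hn) in
theorem gen_eq_monomial (l₁ l₂ : ℕ) :
    gen hn F l₁ l₂ = monomial
      (Finsupp.single (.inl (fst hn)) l₁ + Finsupp.single (.inr (lst hn)) l₂) 1 := by
  rw [gen, X_pow_eq_monomial, X_pow_eq_monomial, monomial_mul, one_mul]

variable (hn) in
theorem gen_ne_zero (l₁ l₂ : ℕ) : gen hn F l₁ l₂ ≠ 0 :=
  mul_ne_zero (pow_ne_zero _ (X_ne_zero _)) (pow_ne_zero _ (X_ne_zero _))

theorem dx_gen_eq_zero {r : Fin n} (hr : r ≠ fst hn) (l₁ l₂ : ℕ) :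
    dx r (gen hn F l₁ l₂) = 0 := by
  rw [gen_eq_monomial, pderiv_monomial]
  simp [hr.symm]

theorem dy_gen_eq_zero {r : Fin n} (hr : r ≠ lst hn) (l₁ l₂ : ℕ) :
    dy r (gen hn F l₁ l₂) = 0 := by
  rw [gen_eq_monomial, pderiv_monomial]
  simp [hr.symm]

theorem opE_gen_eq_zero {i j : Fin n} (hij : i < j) (l₁ l₂ : ℕ) :
    opE i j (gen hn F l₁ l₂) = 0 := by
  have hj : j ≠ fst hn := by
    rintro rfl
    exact absurd (Fin.lt_def.1 hij) (Nat.not_lt_zero _)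
  have hi : i ≠ lst hn := by
    simp only [lst, ne_eq, Fin.ext_iff]
    omega
  rw [opE_apply, dx_gen_eq_zero hj, dy_gen_eq_zero hi, mul_zero, mul_zero, sub_zero]

variable (hn) in
theorem gen_mem_harmonic (l₁ l₂ : ℕ) : gen hn F l₁ l₂ ∈ harmonic n F l₁ l₂ := by
  refine ⟨?_, ?_⟩
  · rw [gen_eq_monomial]
    exact monomial_mem_bihomogeneous (by simp [Finsupp.single_apply])
      (by simp [Finsupp.single_apply]) 1
  · rw [SetLike.mem_coe, LinearMap.mem_ker, Delta_apply]
    refine Finset.sum_eq_zero fun k _ => ?_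
    by_cases hk : k = lst hn
    · rw [pderiv_comm, dx_gen_eq_zero (hk ▸ (fst_ne_lst hn).symm), map_zero]
    · rw [dy_gen_eq_zero hk, map_zero]

theorem exists_eq_smul_gen_of_pderiv_eq_zero [CharZero F] {l₁ l₂ : ℕ} {f : Poly n F}
    (hf : f ∈ bihomogeneous n F l₁ l₂) (hx : ∀ r ≠ fst hn, dx r f = 0)
    (hy : ∀ r ≠ lst hn, dy r f = 0) : ∃ c : F, f = c • gen hn F l₁ l₂ := by
  classical
  set t : Fin n ⊕ Fin n →₀ ℕ :=
    Finsupp.single (.inl (fst hn)) l₁ + Finsupp.single (.inr (lst hn)) l₂ with ht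
  have hsupp : ∀ s, coeff s f ≠ 0 → s = t := by
    intro s hs
    have hsx : ∀ r ≠ fst hn, s (.inl r) = 0 := fun r hr =>
      apply_eq_zero_of_pderiv_eq_zero (hx r hr) hs
    have hsy : ∀ r ≠ lst hn, s (.inr r) = 0 := fun r hr =>
      apply_eq_zero_of_pderiv_eq_zero (hy r hr) hs
    obtain ⟨h₁, h₂⟩ := mem_bihomogeneous_iff.1 hf s hs
    rw [Finset.sum_eq_single (fst hn) (fun r _ => hsx r) (by simp)] at h₁
    rw [Finset.sum_eq_single (lst hn) (fun r _ => hsy r) (by simp)] at h₂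
    ext (r | r)
    · by_cases hr : r = fst hn
      · simp [ht, hr, h₁]
      · simp [ht, hsx r hr, hr]
    · by_cases hr : r = lst hn
      · simp [ht, hr, h₂]
      · simp [ht, hsy r hr, hr]
  refine ⟨coeff t f, ?_⟩
  rw [gen_eq_monomial, ← ht, smul_monomial, smul_eq_mul, mul_one]
  ext s
  rw [coeff_monomial]
  split_ifs with hs
  · rw [hs]
  · exact by_contra fun h => hs (hsupp s h).symm

theorem gen_mem_of_ne_bot [CharZero F] {l₁ l₂ : ℕ} {N : Submodule F (Poly n F)} (hbot : N ≠ ⊥)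
    (hN : N ≤ harmonic n F l₁ l₂) (hE : ∀ i j, i < j → ∀ f ∈ N, opE i j f ∈ N) :
    gen hn F l₁ l₂ ∈ N := by
  obtain ⟨f, hf, hf0, hs⟩ := exists_ne_zero_forall_opE_eq_zero hbot hE
  obtain ⟨hbi, hΔ⟩ := hN hf
  obtain ⟨c, rfl⟩ := exists_eq_smul_gen_of_pderiv_eq_zero (hn := hn) hbi
    (fun r => dx_eq_zero_of_ne_fst hΔ (hs _)) (fun r => dy_eq_zero_of_ne_lst hΔ hs)
  exact (N.smul_mem_iff (left_ne_zero_of_smul hf0)).1 hf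

end Singular

section HighestWeight

variable {n : ℕ} {F : Type*} [Field F]

section Irreducible

variable {hn : 2 ≤ n} {l₁ l₂ : ℕ}

theorem gen_mem_V : gen hn F l₁ l₂ ∈ V hn F l₁ l₂ :=
  LieSubmodule.subset_lieSpan rfl

theorem V_le_iff {N : LieSubmodule F (sl (Fin n) F) (Poly n F)} :
    V hn F l₁ l₂ ≤ N ↔ gen hn F l₁ l₂ ∈ N :=
  LieSubmodule.lieSpan_le.trans Set.singleton_subset_iff

theorem V_le_harmonicLie : V hn F l₁ l₂ ≤ harmonicLie n F l₁ l₂ :=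
  V_le_iff.2 (gen_mem_harmonic hn l₁ l₂)

theorem V_le_of_ne_bot [CharZero F] {N : LieSubmodule F (sl (Fin n) F) (Poly n F)} (hbot : N ≠ ⊥)
    (hN : N ≤ harmonicLie n F l₁ l₂) : V hn F l₁ l₂ ≤ N := by
  refine V_le_iff.2 (gen_mem_of_ne_bot (N := N.toSubmodule) ?_ hN fun i j hij f hf => ?_)
  · rwa [Ne, LieSubmodule.toSubmodule_eq_bot]
  · rw [opE_apply, ← lie_single i j hij.ne]
    exact N.lie_mem hf

theorem isAtom_V [CharZero F] : IsAtom (V hn F l₁ l₂) := by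
  refine ⟨fun h => gen_ne_zero (F := F) hn l₁ l₂ ?_, fun N hN => by_contra fun hbot => hN.not_ge ?_⟩
  · rw [← LieSubmodule.mem_bot (R := F) (L := sl (Fin n) F), ← h]
    exact gen_mem_V
  · exact V_le_of_ne_bot hbot (hN.le.trans V_le_harmonicLie)

theorem disjoint_harmonicLie_apolarOrthogonal_V [CharZero F] :
    Disjoint (harmonicLie n F l₁ l₂) (apolarOrthogonal (V hn F l₁ l₂)) := by
  refine disjoint_iff.2 (by_contra fun hbot => ?_)
  have hmem := V_le_iff.1 ((V_le_of_ne_bot (hn := hn) hbot inf_le_left).trans inf_le_right)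
  have hgen : apolar _ F (gen hn F l₁ l₂) (gen hn F l₁ l₂) = 0 := hmem _ gen_mem_V
  rw [gen_eq_monomial] at hgen
  exact apolar_monomial_self_ne_zero _ hgen

theorem V_eq_harmonic [CharZero F] : (V hn F l₁ l₂).toSubmodule = harmonic n F l₁ l₂ := by
  have := finite_bihomogeneous (n := n) (F := F) l₁ l₂
  have : FiniteDimensional F (harmonic n F l₁ l₂) := Submodule.finiteDimensional_of_le inf_le_left
  refine eq_of_le_of_disjoint_orthogonal (B := apolar _ F) V_le_harmonicLie ?_
  exact LieSubmodule.disjoint_toSubmodule.2 disjoint_harmonicLie_apolarOrthogonal_V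

end Irreducible

theorem apply_eq_zero_of_mem_cartan {h : sl (Fin n) F} (hh : h ∈ cartan n F) {i j : Fin n}
    (hij : i ≠ j) : h.1 i j = 0 := by
  induction hh using Submodule.span_induction with
  | mem h hh =>
    obtain ⟨k, l, -, rfl⟩ := hh
    simp only [val_singleSubSingle, Matrix.sub_apply, Matrix.single_apply]
    rw [if_neg fun hk => hij (hk.1.symm.trans hk.2), if_neg fun hl => hij (hl.1.symm.trans hl.2),
      sub_zero]
  | zero => rfl
  | add a b _ _ ha hb =>
    change a.1 i j + b.1 i j = 0
    rw [ha, hb, add_zero]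
  | smul c a _ ha =>
    change c * a.1 i j = 0
    rw [ha, mul_zero]

variable {hn : 2 ≤ n}

theorem fundamentalWeight_one_apply (h : cartan n F) :
    fundamentalWeight n F 1 h = h.1.1 (fst hn) (fst hn) := by
  refine (Fintype.sum_eq_single (fst hn) fun j hj => if_neg ?_).trans (if_pos one_pos)
  exact fun h => hj (Fin.ext (Nat.lt_one_iff.1 h))

theorem fundamentalWeight_pred_apply (h : cartan n F) :
    fundamentalWeight n F (n - 1) h = -h.1.1 (lst hn) (lst hn) := by
  classical
  have htr : ∑ j, h.1.1 j j = 0 := h.1.2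
  rw [← Finset.sum_erase_add _ _ (Finset.mem_univ (lst hn))] at htr
  rw [← eq_neg_of_add_eq_zero_left htr]
  refine (Finset.sum_erase_add _ _ (Finset.mem_univ (lst hn))).symm.trans ?_
  rw [if_neg (show ¬(lst hn : ℕ) < n - 1 from lt_irrefl _), add_zero]
  exact Finset.sum_congr rfl fun j hj => if_pos (lt_lst (Finset.ne_of_mem_erase hj))

theorem act_gen_of_diag {A : Matrix (Fin n) (Fin n) F} (hA : ∀ i j, i ≠ j → A i j = 0)
    (l₁ l₂ : ℕ) :
    act A (gen hn F l₁ l₂) =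
      (l₁ * A (fst hn) (fst hn) - l₂ * A (lst hn) (lst hn)) • gen hn F l₁ l₂ := by
  have hx : act A (x (fst hn)) = A (fst hn) (fst hn) • x (fst hn) := by
    rw [act_x]
    exact Finset.sum_eq_single _ (fun i _ hi => by rw [hA _ _ hi, zero_smul]) (by simp)
  have hy : act A (y (lst hn)) = -(A (lst hn) (lst hn) • y (lst hn)) := by
    rw [act_y]
    congr 1
    exact Finset.sum_eq_single _ (fun i _ hi => by rw [hA _ _ hi.symm, zero_smul]) (by simp)
  rw [gen, Derivation.leibniz, Derivation.leibniz_pow, Derivation.leibniz_pow, hx, hy]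
  simp only [smul_eq_mul, MvPolynomial.smul_eq_C_mul, nsmul_eq_mul, map_sub, map_mul, map_natCast]
  rcases l₁ with _ | l₁ <;> rcases l₂ with _ | l₂ <;> simp [pow_succ] <;> ring

variable (hn) in
theorem isSingularVector_gen (l₁ l₂ : ℕ) :
    IsSingularVector (l₁ • fundamentalWeight n F 1 + l₂ • fundamentalWeight n F (n - 1))
      (gen hn F l₁ l₂) where
  ne_zero := gen_ne_zero hn l₁ l₂
  lie_pos i j hij := (lie_single i j hij.ne _).trans (opE_gen_eq_zero hij l₁ l₂)
  lie_cartan h := by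
    rw [lie_def, act_gen_of_diag fun i j => apply_eq_zero_of_mem_cartan h.2, LinearMap.add_apply,
      LinearMap.smul_apply, LinearMap.smul_apply, fundamentalWeight_one_apply (hn := hn),
      fundamentalWeight_pred_apply (hn := hn), nsmul_eq_mul, nsmul_eq_mul, mul_neg, sub_eq_add_neg]

theorem isHighestWeightModule_of_isAtom {M : Type*} [AddCommGroup M] [Module F M]
    [LieRingModule (sl (Fin n) F) M]
    {N : LieSubmodule F (sl (Fin n) F) M} (hN : IsAtom N)
    {lam : Module.Dual F (cartan n F)} {v : M} (hvN : v ∈ N) (hv : IsSingularVector lam v) :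
    IsHighestWeightModule N lam := by
  have := isIrreducible_of_isAtom hN
  refine ⟨⟨v, hvN⟩, ⟨fun h => hv.ne_zero (congrArg Subtype.val h), ?_, ?_⟩, ?_⟩
  · exact fun i j hij => Subtype.ext (hv.lie_pos i j hij)
  · exact fun h => Subtype.ext (hv.lie_cartan h)
  · refine (eq_bot_or_eq_top _).resolve_left fun h => ?_
    rw [LieSubmodule.lieSpan_eq_bot_iff] at h
    exact hv.ne_zero (congrArg Subtype.val (h _ rfl))

end HighestWeight

section MultiIndex

variable {ι : Type*} [Fintype ι] [DecidableEq ι]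

theorem sum_add_single (i : ι → ℕ) (r : ι) : ∑ q, (i + Pi.single r 1 : ι → ℕ) q = ∑ q, i q + 1 := by
  simp [Finset.sum_add_distrib]

theorem prod_add_single_mul {M : Type*} [CommMonoid M] {g : ι → ℕ → M} {i : ι → ℕ} {r : ι}
    {c d : M} (h : g r (i r + 1) * c = g r (i r) * d) :
    (∏ q, g q ((i + Pi.single r 1 : ι → ℕ) q)) * c = (∏ q, g q (i q)) * d := by
  have hrest : ∏ q ∈ Finset.univ.erase r, g q ((i + Pi.single r 1 : ι → ℕ) q) =
      ∏ q ∈ Finset.univ.erase r, g q (i q) :=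
    Finset.prod_congr rfl fun q hq => by simp [Finset.ne_of_mem_erase hq]
  rw [← Finset.mul_prod_erase _ _ (Finset.mem_univ r), hrest,
    ← Finset.mul_prod_erase _ (fun q => g q (i q)) (Finset.mem_univ r), Pi.add_apply,
    Pi.single_eq_same, mul_right_comm, h, mul_right_comm]

theorem sum_Iic_add_single {M : Type*} [AddCommMonoid M] {T : (ι → ℕ) → M} {b : ι → ℕ} {r : ι}
    (hzero : ∀ i : ι → ℕ, i r = 0 → T i = 0)
    (htop : ∀ i : ι → ℕ, i r = b r → T (i + Pi.single r 1) = 0) :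
    ∑ i ∈ Finset.Iic b, T (i + Pi.single r 1) = ∑ i ∈ Finset.Iic b, T i := by
  refine Finset.sum_bij_ne_zero (fun i _ _ => i + Pi.single r 1) ?_
    (fun i _ _ j _ _ h => add_right_cancel h) ?_ (fun _ _ _ => rfl)
  · intro i hi h
    rw [Finset.mem_Iic] at hi ⊢
    intro q
    rcases eq_or_ne q r with rfl | hq
    · simpa using lt_of_le_of_ne (hi q) fun hb => h (htop i hb)
    · simpa [hq] using hi q
  · intro j hj h
    have hsub : j - Pi.single r 1 + Pi.single r 1 = j := by
      refine tsub_add_cancel_of_le fun q => ?_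
      rcases eq_or_ne q r with rfl | hq
      · simpa using Nat.one_le_iff_ne_zero.2 fun h0 => h (hzero j h0)
      · simp [hq]
    exact ⟨j - Pi.single r 1, Finset.mem_Iic.2 (tsub_le_self.trans (Finset.mem_Iic.1 hj)),
      by rwa [hsub], hsub⟩

end MultiIndex

section HarmonicCoeff

open scoped Nat

theorem factorial_mul_choose_mul_choose_succ (M N k : ℕ) :
    (k + 1)! * M.choose (k + 1) * N.choose (k + 1) * (k + 1) =
      k ! * M.choose k * N.choose k * ((M - k) * (N - k)) := by
  calc (k + 1)! * M.choose (k + 1) * N.choose (k + 1) * (k + 1)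
      = k ! * (M.choose (k + 1) * (k + 1)) * (N.choose (k + 1) * (k + 1)) := by
        rw [Nat.factorial_succ]
        ring
    _ = k ! * M.choose k * N.choose k * ((M - k) * (N - k)) := by
        rw [Nat.choose_succ_right_eq, Nat.choose_succ_right_eq]
        ring

variable {ι : Type*} [Fintype ι] {F : Type*} [Field F]

variable (F) in
/-- The coefficient with index `i = (i₂,…,iₙ)` in the two families of harmonic polynomials. -/
noncomputable def harmonicCoeff (m : ℕ) (μ ν i : ι → ℕ) : F :=
  ((-1) ^ (∑ r, i r) * ∏ r, (((μ r).choose (i r) : F) * ((ν r).choose (i r) : F))) /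
    (((m + ∑ r, i r).choose m : F) * (Nat.multinomial Finset.univ i : F))

theorem harmonicCoeff_zero (m : ℕ) (μ ν : ι → ℕ) : harmonicCoeff F m μ ν 0 = 1 := by
  simp [harmonicCoeff, Nat.multinomial]

variable [CharZero F]

theorem harmonicCoeff_mul_factorial (m : ℕ) (μ ν i : ι → ℕ) :
    harmonicCoeff F m μ ν i * (m + ∑ r, i r)! =
      (-1) ^ (∑ r, i r) * m ! *
        ((∏ r, ((i r)! * (μ r).choose (i r) * (ν r).choose (i r)) : ℕ) : F) := by
  have hfac : (m + ∑ r, i r)! =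
      ((m + ∑ r, i r).choose m * Nat.multinomial Finset.univ i) * (m ! * ∏ r, (i r)!) := by
    rw [Nat.choose_symm_add, ← Nat.add_choose_mul_factorial_mul_factorial,
      ← Nat.multinomial_spec Finset.univ i]
    ring
  have hne : ((m + ∑ r, i r)! : F) ≠ 0 := Nat.cast_ne_zero.2 (Nat.factorial_ne_zero _)
  rw [hfac, Nat.cast_mul] at hne
  rw [hfac, harmonicCoeff, Nat.cast_mul, ← Nat.cast_mul, ← mul_assoc,
    div_mul_cancel₀ _ (left_ne_zero_of_mul hne), Finset.prod_mul_distrib, Finset.prod_mul_distrib,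
    Finset.prod_mul_distrib]
  push_cast
  ring

theorem harmonicCoeff_add_single [DecidableEq ι] (m : ℕ) (μ ν i : ι → ℕ) (r : ι) :
    harmonicCoeff F m μ ν (i + Pi.single r 1) * (((m + ∑ q, i q + 1) * (i r + 1) : ℕ) : F) =
      -(harmonicCoeff F m μ ν i * (((μ r - i r) * (ν r - i r) : ℕ) : F)) := by
  have hne : ((m + ∑ q, i q)! : F) ≠ 0 := Nat.cast_ne_zero.2 (Nat.factorial_ne_zero _)
  have hprod := congrArg (Nat.cast (R := F)) (prod_add_single_mul
    (g := fun q k => k ! * (μ q).choose k * (ν q).choose k)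
    (factorial_mul_choose_mul_choose_succ (μ r) (ν r) (i r)))
  have hsucc := harmonicCoeff_mul_factorial (F := F) m μ ν (i + Pi.single r 1)
  have hi := harmonicCoeff_mul_factorial (F := F) m μ ν i
  rw [sum_add_single, ← add_assoc, Nat.factorial_succ, pow_succ] at hsucc
  refine mul_right_cancel₀ hne ?_
  push_cast at hprod hsucc hi ⊢
  linear_combination (i r + 1 : F) * hsucc - (-1) ^ (∑ q, i q) * m ! * hprod +
    ((μ r - i r : ℕ) : F) * ((ν r - i r : ℕ) : F) * hi

end HarmonicCoeff

section Exponent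

variable {n : ℕ} {hn : 2 ≤ n}

theorem ne_fst_iff {k : Fin n} : k ≠ fst hn ↔ 0 < (k : ℕ) := by
  simp only [fst, ne_eq, Fin.ext_iff]
  omega

theorem rest_ne_fst (r : Rest n) : r.1 ≠ fst hn := ne_fst_iff.2 r.2

@[to_additive]
theorem prod_eq_fst_mul {M : Type*} [CommMonoid M] (hn : 2 ≤ n) (g : Fin n → M) :
    ∏ k, g k = g (fst hn) * ∏ r : Rest n, g r.1 := by
  classical
  rw [← Finset.mul_prod_erase _ _ (Finset.mem_univ (fst hn))]
  congr 1
  exact Finset.prod_subtype _ (fun k => by simp [ne_fst_iff]) _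

/-- The exponent of the monomial `x₁^a y₁^b ∏ x_r^{μ_r} y_r^{ν_r}`. -/
noncomputable def exponent (a b : ℕ) (μ ν : Rest n → ℕ) : Fin n ⊕ Fin n →₀ ℕ :=
  Finsupp.equivFunOnFinite.symm <| Sum.elim
    (fun k => if h : 0 < (k : ℕ) then μ ⟨k, h⟩ else a)
    (fun k => if h : 0 < (k : ℕ) then ν ⟨k, h⟩ else b)

variable (a b : ℕ) (μ ν : Rest n → ℕ)

@[simp]
theorem exponent_inl_fst : exponent a b μ ν (.inl (fst hn)) = a := by
  simp [exponent, fst]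

@[simp]
theorem exponent_inr_fst : exponent a b μ ν (.inr (fst hn)) = b := by
  simp [exponent, fst]

@[simp]
theorem exponent_inl_rest (r : Rest n) : exponent a b μ ν (.inl r.1) = μ r := by
  simp [exponent, r.2]

@[simp]
theorem exponent_inr_rest (r : Rest n) : exponent a b μ ν (.inr r.1) = ν r := by
  simp [exponent, r.2]

variable {a b μ ν}

theorem eq_exponent {s : Fin n ⊕ Fin n →₀ ℕ} (ha : s (.inl (fst hn)) = a)
    (hb : s (.inr (fst hn)) = b) (hμ : ∀ r : Rest n, s (.inl r.1) = μ r)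
    (hν : ∀ r : Rest n, s (.inr r.1) = ν r) : s = exponent a b μ ν := by
  ext (k | k) <;> by_cases hk : k = fst hn
  · rw [hk, ha, exponent_inl_fst]
  · exact (hμ ⟨k, ne_fst_iff.1 hk⟩).trans (exponent_inl_rest a b μ ν ⟨k, ne_fst_iff.1 hk⟩).symm
  · rw [hk, hb, exponent_inr_fst]
  · exact (hν ⟨k, ne_fst_iff.1 hk⟩).trans (exponent_inr_rest a b μ ν ⟨k, ne_fst_iff.1 hk⟩).symm

theorem exponent_tsub_single_fst (hn : 2 ≤ n) :
    exponent a b μ ν - Finsupp.single (.inr (fst hn)) 1 - Finsupp.single (.inl (fst hn)) 1 =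
      exponent (a - 1) (b - 1) μ ν := by
  have hr := rest_ne_fst (hn := hn)
  refine eq_exponent (hn := hn) ?_ ?_ (fun r => ?_) (fun r => ?_) <;> simp [hr]

theorem exponent_tsub_single_rest (hn : 2 ≤ n) (r : Rest n) :
    exponent a b μ ν - Finsupp.single (.inr r.1) 1 - Finsupp.single (.inl r.1) 1 =
      exponent a b (μ - Pi.single r 1) (ν - Pi.single r 1) := by
  have hr := rest_ne_fst (hn := hn)
  refine eq_exponent (hn := hn) ?_ ?_ (fun q => ?_) (fun q => ?_) <;>
    simp [hr, Finsupp.single_apply, Pi.single_apply, Subtype.coe_inj, eq_comm]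

theorem sum_exponent_inl (hn : 2 ≤ n) : ∑ k, exponent a b μ ν (.inl k) = a + ∑ r, μ r := by
  simp [sum_eq_fst_add hn]

theorem sum_exponent_inr (hn : 2 ≤ n) : ∑ k, exponent a b μ ν (.inr k) = b + ∑ r, ν r := by
  simp [sum_eq_fst_add hn]

variable {F : Type*} [Field F]

theorem monomial_exponent (c : F) :
    monomial (exponent a b μ ν) c =
      C c * (x (fst hn) ^ a * y (fst hn) ^ b * ∏ r : Rest n, (x r.1 ^ μ r * y r.1 ^ ν r)) := by
  rw [monomial_eq, Finsupp.prod_fintype _ _ (fun _ => pow_zero _), Fintype.prod_sum_type,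
    prod_eq_fst_mul hn, prod_eq_fst_mul hn, Finset.prod_mul_distrib]
  simp only [exponent_inl_fst, exponent_inr_fst, exponent_inl_rest, exponent_inr_rest]
  ring

theorem dx_dy_monomial (k : Fin n) (s : Fin n ⊕ Fin n →₀ ℕ) (c : F) :
    dx k (dy k (monomial s c)) =
      monomial (s - Finsupp.single (.inr k) 1 - Finsupp.single (.inl k) 1)
        (c * ((s (.inl k) * s (.inr k) : ℕ) : F)) := by
  rw [pderiv_monomial, pderiv_monomial]
  simp [mul_comm, mul_left_comm]

theorem Delta_monomial_exponent (hn : 2 ≤ n) (c : F) :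
    Delta n F (monomial (exponent a b μ ν) c) =
      monomial (exponent (a - 1) (b - 1) μ ν) (c * ((a * b : ℕ) : F)) +
        ∑ r, monomial (exponent a b (μ - Pi.single r 1) (ν - Pi.single r 1))
          (c * ((μ r * ν r : ℕ) : F)) := by
  rw [Delta_apply, sum_eq_fst_add hn]
  simp only [dx_dy_monomial, exponent_tsub_single_fst, exponent_tsub_single_rest hn,
    exponent_inl_fst, exponent_inr_fst, exponent_inl_rest, exponent_inr_rest]

end Exponent

section HarmonicPoly

variable {n : ℕ} {F : Type*} [Field F]

variable (F) in
/-- The common form of the two families: the first is the case `b = 0`, the second is the case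
`a = 0`. -/
noncomputable def harmonicPoly (a b : ℕ) (μ ν : Rest n → ℕ) : Poly n F :=
  ∑ i ∈ Finset.Iic (μ ⊓ ν),
    monomial (exponent (a + ∑ r, i r) (b + ∑ r, i r) (μ - i) (ν - i))
      (harmonicCoeff F (a + b) μ ν i)

theorem basisFst_eq_harmonicPoly (hn : 2 ≤ n) (m : ℕ) (μ ν : Rest n → ℕ) :
    basisFst hn F m μ ν = harmonicPoly F m 0 μ ν := by
  refine Finset.sum_congr rfl fun i _ => ?_
  rw [monomial_exponent (hn := hn), add_zero, zero_add]
  rfl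

theorem basisSnd_eq_harmonicPoly (hn : 2 ≤ n) (m : ℕ) (μ ν : Rest n → ℕ) :
    basisSnd hn F m μ ν = harmonicPoly F 0 m μ ν := by
  refine Finset.sum_congr rfl fun i _ => ?_
  rw [monomial_exponent (hn := hn), zero_add, zero_add]
  rfl

theorem coeff_harmonicPoly (hn : 2 ≤ n) {a b : ℕ} (μ ν : Rest n → ℕ) {t : Fin n ⊕ Fin n →₀ ℕ}
    (ht : t (.inl (fst hn)) = 0 ∨ t (.inr (fst hn)) = 0) :
    coeff t (harmonicPoly F a b μ ν) = if exponent a b μ ν = t then 1 else 0 := by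
  classical
  rw [harmonicPoly, coeff_sum, Finset.sum_eq_single 0]
  · simp [coeff_monomial, harmonicCoeff_zero]
  · intro i _ hi
    rw [coeff_monomial, if_neg]
    rintro rfl
    rw [exponent_inl_fst, exponent_inr_fst] at ht
    have hsum : ∑ r, i r = 0 := by omega
    exact hi (funext fun r => Finset.sum_eq_zero_iff.1 hsum r (Finset.mem_univ r))
  · exact fun h => absurd (Finset.mem_Iic.2 fun r => Nat.zero_le _) h

theorem harmonicPoly_mem_bihomogeneous (hn : 2 ≤ n) (a b : ℕ) (μ ν : Rest n → ℕ) :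
    harmonicPoly F a b μ ν ∈ bihomogeneous n F (a + ∑ r, μ r) (b + ∑ r, ν r) := by
  refine Submodule.sum_mem _ fun i hi => monomial_mem_bihomogeneous ?_ ?_ _
  · have hμ : i ≤ μ := (Finset.mem_Iic.1 hi).trans inf_le_left
    rw [sum_exponent_inl hn, add_assoc, ← Finset.sum_add_distrib]
    exact congrArg (a + ∑ r, · r) (add_tsub_cancel_of_le hμ)
  · have hν : i ≤ ν := (Finset.mem_Iic.1 hi).trans inf_le_right
    rw [sum_exponent_inr hn, add_assoc, ← Finset.sum_add_distrib]
    exact congrArg (b + ∑ r, · r) (add_tsub_cancel_of_le hν)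

variable (F) in
/-- The part with index `r` of `∂_{x₁} ∂_{y₁}` of the term with index `i` of
`harmonicPoly F a b μ ν`, when `(a + |i|) (b + |i|) = (a + b + |i|) |i|` is split as
`∑ r, (a + b + |i|) i_r`. -/
noncomputable def deltaPart (a b : ℕ) (μ ν : Rest n → ℕ) (r : Rest n) (i : Rest n → ℕ) :
    Poly n F :=
  monomial (exponent (a + ∑ q, i q - 1) (b + ∑ q, i q - 1) (μ - i) (ν - i))
    (harmonicCoeff F (a + b) μ ν i * (((a + b + ∑ q, i q) * i r : ℕ) : F))

theorem deltaPart_eq_zero (a b : ℕ) (μ ν : Rest n → ℕ) {r : Rest n} {i : Rest n → ℕ}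
    (hi : i r = 0) : deltaPart F a b μ ν r i = 0 := by
  simp [deltaPart, hi]

variable [CharZero F]

theorem deltaPart_add_single (a b : ℕ) (μ ν : Rest n → ℕ) (r : Rest n) (i : Rest n → ℕ) :
    deltaPart F a b μ ν r (i + Pi.single r 1) =
      -monomial (exponent (a + ∑ q, i q) (b + ∑ q, i q) (μ - i - Pi.single r 1)
        (ν - i - Pi.single r 1))
        (harmonicCoeff F (a + b) μ ν i * (((μ r - i r) * (ν r - i r) : ℕ) : F)) := by
  rw [deltaPart, sum_add_single, Pi.add_apply, Pi.single_eq_same, ← add_assoc, ← add_assoc,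
    ← add_assoc, Nat.add_sub_cancel, Nat.add_sub_cancel, harmonicCoeff_add_single, tsub_tsub,
    tsub_tsub, map_neg]

theorem deltaPart_add_single_eq_zero (a b : ℕ) {μ ν : Rest n → ℕ} {r : Rest n} {i : Rest n → ℕ}
    (hi : i r = (μ ⊓ ν) r) : deltaPart F a b μ ν r (i + Pi.single r 1) = 0 := by
  have : (μ r - i r) * (ν r - i r) = 0 := by
    rw [hi, Pi.inf_apply, mul_eq_zero]
    exact (min_choice (μ r) (ν r)).imp (fun h => by omega) (fun h => by omega)
  rw [deltaPart_add_single, this, Nat.cast_zero, mul_zero, map_zero, neg_zero]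

theorem Delta_monomial_harmonicCoeff (hn : 2 ≤ n) {a b : ℕ} (hab : a = 0 ∨ b = 0)
    (μ ν i : Rest n → ℕ) :
    Delta n F (monomial (exponent (a + ∑ r, i r) (b + ∑ r, i r) (μ - i) (ν - i))
      (harmonicCoeff F (a + b) μ ν i)) =
    ∑ r, (deltaPart F a b μ ν r i - deltaPart F a b μ ν r (i + Pi.single r 1)) := by
  have hsplit : (a + ∑ r, i r) * (b + ∑ r, i r) = ∑ r, (a + b + ∑ q, i q) * i r := by
    rw [← Finset.mul_sum]
    rcases hab with rfl | rfl <;> ring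
  rw [Delta_monomial_exponent hn, hsplit, Nat.cast_sum, Finset.mul_sum, map_sum,
    ← Finset.sum_add_distrib]
  refine Finset.sum_congr rfl fun r _ => ?_
  rw [deltaPart_add_single, sub_neg_eq_add]
  rfl

theorem Delta_harmonicPoly (hn : 2 ≤ n) {a b : ℕ} (hab : a = 0 ∨ b = 0) (μ ν : Rest n → ℕ) :
    Delta n F (harmonicPoly F a b μ ν) = 0 := by
  simp only [harmonicPoly, map_sum, Delta_monomial_harmonicCoeff hn hab]
  rw [Finset.sum_comm]
  refine Finset.sum_eq_zero fun r _ => ?_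
  rw [Finset.sum_sub_distrib, sub_eq_zero, eq_comm]
  exact sum_Iic_add_single (fun i => deltaPart_eq_zero a b μ ν)
    (fun i => deltaPart_add_single_eq_zero a b)

end HarmonicPoly

section Basis

variable {n : ℕ} {F : Type*} [Field F]

theorem coeff_Delta (f : Poly n F) (u : Fin n ⊕ Fin n →₀ ℕ) :
    coeff u (Delta n F f) = ∑ k : Fin n,
      coeff (u + Finsupp.single (.inl k) 1 + Finsupp.single (.inr k) 1) f *
        (u (.inr k) + 1) * (u (.inl k) + 1) := by
  rw [Delta_apply, coeff_sum]
  refine Finset.sum_congr rfl fun k _ => ?_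
  rw [coeff_pderiv, coeff_pderiv]
  simp

-- At `u`, the equation `Δ f = 0` gives the coefficient of `f` at `u x_p y_p` in terms of
-- coefficients at exponents with the same degree in `x_p` as `u`.
theorem eq_zero_of_Delta_eq_zero [CharZero F] (p : Fin n) {f : Poly n F} (hf : Delta n F f = 0)
    (h : ∀ s, s (.inl p) = 0 ∨ s (.inr p) = 0 → coeff s f = 0) : f = 0 := by
  ext s
  induction hd : s (.inl p) generalizing s with
  | zero => exact h s (.inl hd)
  | succ d ih =>
    by_cases hy : s (.inr p) = 0
    · exact h s (.inr hy)
    obtain ⟨u, rfl⟩ : ∃ u, s = u + Finsupp.single (.inl p) 1 + Finsupp.single (.inr p) 1 := by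
      refine ⟨s - Finsupp.single (.inr p) 1 - Finsupp.single (.inl p) 1, ?_⟩
      rw [Finsupp.sub_add_single_one_cancel, Finsupp.sub_add_single_one_cancel hy]
      simp [hd]
    have hu := coeff_Delta f u
    rw [hf, coeff_zero, Fintype.sum_eq_single p, eq_comm, mul_eq_zero, mul_eq_zero] at hu
    · exact (hu.resolve_right (Nat.cast_add_one_ne_zero _)).resolve_right
        (Nat.cast_add_one_ne_zero _)
    · intro k hk
      rw [ih, coeff_zero, zero_mul, zero_mul]
      simpa [hk] using hd

variable (hn : 2 ≤ n)

/-- The exponents of bidegree `(l₁,l₂)` that are not divisible by `x₁ y₁`. They index the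
basis. -/
def reducedExponents (l₁ l₂ : ℕ) : Set (Fin n ⊕ Fin n →₀ ℕ) :=
  {s | (∑ k, s (.inl k) = l₁ ∧ ∑ k, s (.inr k) = l₂) ∧
    (s (.inl (fst hn)) = 0 ∨ s (.inr (fst hn)) = 0)}

variable (F) in
/-- For `s` not divisible by `x₁ y₁`, the unique harmonic polynomial equal to the monomial with
exponent `s` modulo `x₁ y₁`. -/
noncomputable def harmonicExtension (s : Fin n ⊕ Fin n →₀ ℕ) : Poly n F :=
  harmonicPoly F (s (.inl (fst hn))) (s (.inr (fst hn))) (fun r => s (.inl r.1))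
    (fun r => s (.inr r.1))

theorem harmonicExtension_exponent (a b : ℕ) (μ ν : Rest n → ℕ) :
    harmonicExtension F hn (exponent a b μ ν) = harmonicPoly F a b μ ν := by
  simp only [harmonicExtension, exponent_inl_fst, exponent_inr_fst, exponent_inl_rest,
    exponent_inr_rest]

theorem coeff_harmonicExtension (s : Fin n ⊕ Fin n →₀ ℕ) {t : Fin n ⊕ Fin n →₀ ℕ}
    (ht : t (.inl (fst hn)) = 0 ∨ t (.inr (fst hn)) = 0) :
    coeff t (harmonicExtension F hn s) = if s = t then 1 else 0 := by
  rw [harmonicExtension, coeff_harmonicPoly hn _ _ ht,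
    ← eq_exponent (hn := hn) rfl rfl (fun _ => rfl) (fun _ => rfl)]

variable {l₁ l₂ : ℕ}

theorem harmonicExtension_mem_harmonic [CharZero F] {s : Fin n ⊕ Fin n →₀ ℕ}
    (hs : s ∈ reducedExponents hn l₁ l₂) : harmonicExtension F hn s ∈ harmonic n F l₁ l₂ := by
  obtain ⟨⟨rfl, rfl⟩, hab⟩ := hs
  rw [sum_eq_fst_add hn, sum_eq_fst_add hn]
  exact ⟨harmonicPoly_mem_bihomogeneous hn _ _ _ _, Delta_harmonicPoly hn hab _ _⟩

theorem exponent_mem_reducedExponents {a b : ℕ} (hab : a = 0 ∨ b = 0) {μ ν : Rest n → ℕ}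
    (hμ : a + ∑ r, μ r = l₁) (hν : b + ∑ r, ν r = l₂) :
    exponent a b μ ν ∈ reducedExponents hn l₁ l₂ :=
  ⟨⟨(sum_exponent_inl hn).trans hμ, (sum_exponent_inr hn).trans hν⟩, by simpa using hab⟩

theorem basisSet_eq_image :
    basisSet hn F l₁ l₂ = harmonicExtension F hn '' reducedExponents hn l₁ l₂ := by
  ext f
  constructor
  · rintro (⟨m, μ, ν, hμ, hν, rfl⟩ | ⟨m, μ, ν, hμ, hν, rfl⟩)
    · rw [basisFst_eq_harmonicPoly, ← harmonicExtension_exponent hn]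
      exact ⟨_, exponent_mem_reducedExponents hn (.inr rfl) hμ ((zero_add _).trans hν), rfl⟩
    · rw [basisSnd_eq_harmonicPoly, ← harmonicExtension_exponent hn]
      exact ⟨_, exponent_mem_reducedExponents hn (.inl rfl) ((zero_add _).trans hμ) hν, rfl⟩
  · rintro ⟨s, ⟨⟨hx, hy⟩, h | h⟩, rfl⟩ <;> rw [sum_eq_fst_add hn] at hx hy
    · rw [h, zero_add] at hx
      exact .inr ⟨_, _, _, hx, hy, by rw [basisSnd_eq_harmonicPoly, harmonicExtension, h]⟩
    · rw [h, zero_add] at hy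
      exact .inl ⟨_, _, _, hx, hy, by rw [basisFst_eq_harmonicPoly, harmonicExtension, h]⟩

theorem linearIndepOn_basisSet : LinearIndepOn F id (basisSet hn F l₁ l₂) := by
  classical
  rw [basisSet_eq_image]
  let reducedCoeffs : Poly n F →ₗ[F] reducedExponents hn l₁ l₂ → F :=
    LinearMap.pi fun t => lcoeff F t.1
  refine LinearIndepOn.id_image (LinearIndependent.of_comp reducedCoeffs ?_)
  have h : (reducedCoeffs ∘ fun s : reducedExponents hn l₁ l₂ => harmonicExtension F hn s.1) =
      fun s => Pi.single s 1 := by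
    ext s t
    simp [reducedCoeffs, coeff_harmonicExtension hn s.1 t.2.2, Pi.single_apply, Subtype.ext_iff,
      eq_comm]
  exact h ▸ Pi.linearIndependent_single_one (reducedExponents hn l₁ l₂) F

theorem eq_sum_coeff_smul_harmonicExtension [CharZero F] {f : Poly n F}
    (hf : f ∈ harmonic n F l₁ l₂) [DecidablePred (· ∈ reducedExponents hn l₁ l₂)] :
    f = ∑ s ∈ f.support with s ∈ reducedExponents hn l₁ l₂,
      coeff s f • harmonicExtension F hn s := by
  classical
  set g := ∑ s ∈ f.support with s ∈ reducedExponents hn l₁ l₂,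
    coeff s f • harmonicExtension F hn s with hg
  have hgmem : g ∈ harmonic n F l₁ l₂ := Submodule.sum_mem _ fun s hs =>
    Submodule.smul_mem _ _ (harmonicExtension_mem_harmonic hn (Finset.mem_filter.1 hs).2)
  refine sub_eq_zero.1 (eq_zero_of_Delta_eq_zero (fst hn) (Submodule.sub_mem _ hf hgmem).2
    fun t ht => ?_)
  rw [coeff_sub, hg, coeff_sum, sub_eq_zero]
  simp only [coeff_smul, coeff_harmonicExtension hn _ ht, smul_eq_mul, mul_ite, mul_one, mul_zero]
  rw [Finset.sum_ite_eq', eq_comm, ite_eq_left_iff]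
  refine fun h => by_contra fun hne => h (Finset.mem_filter.2 ⟨mem_support_iff.2 (Ne.symm hne), ?_⟩)
  exact ⟨mem_bihomogeneous_iff.1 hf.1 t (Ne.symm hne), ht⟩

theorem span_basisSet [CharZero F] :
    Submodule.span F (basisSet hn F l₁ l₂) = harmonic n F l₁ l₂ := by
  classical
  rw [basisSet_eq_image]
  refine le_antisymm (Submodule.span_le.2 ?_) fun f hf => ?_
  · rintro _ ⟨s, hs, rfl⟩
    exact harmonicExtension_mem_harmonic hn hs
  · rw [eq_sum_coeff_smul_harmonicExtension hn hf]
    exact Submodule.sum_mem _ fun s hs => Submodule.smul_mem _ _ <|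
      Submodule.subset_span ⟨s, (Finset.mem_filter.1 hs).2, rfl⟩

end Basis

end SlPoly

theorem theorem4p3 (F : Type*) [Field F] [CharZero F] (n : ℕ) (hn : 2 ≤ n) (l₁ l₂ : ℕ) :
    LieModule.IsIrreducible F (LieAlgebra.SpecialLinear.sl (Fin n) F) (SlPoly.V hn F l₁ l₂) ∧
    SlPoly.IsSingularVector
      (l₁ • SlPoly.fundamentalWeight n F 1 + l₂ • SlPoly.fundamentalWeight n F (n - 1))
      (SlPoly.gen hn F l₁ l₂) ∧
    SlPoly.IsHighestWeightModule (SlPoly.V hn F l₁ l₂)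
      (l₁ • SlPoly.fundamentalWeight n F 1 + l₂ • SlPoly.fundamentalWeight n F (n - 1)) ∧
    (SlPoly.V hn F l₁ l₂).toSubmodule = SlPoly.harmonic n F l₁ l₂ ∧
    LinearIndepOn F id (SlPoly.basisSet hn F l₁ l₂) ∧
    Submodule.span F (SlPoly.basisSet hn F l₁ l₂) = (SlPoly.V hn F l₁ l₂).toSubmodule :=
  open SlPoly in
  ⟨isIrreducible_of_isAtom isAtom_V, isSingularVector_gen hn l₁ l₂,
    isHighestWeightModule_of_isAtom isAtom_V gen_mem_V (isSingularVector_gen hn l₁ l₂),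
    V_eq_harmonic, linearIndepOn_basisSet hn, (span_basisSet hn).trans V_eq_harmonic.symm⟩
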